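/- Let $n\ge 2$ be an integer. There is a constant $c_3(n)>0$ depending only on $n$ with the following property. Let $\Lambda$ be a (full-rank) lattice in $\mathbb{R}^n$ and let $\mathcal{C}\subset\mathbb{R}^n$ be a symmetric convex body, i.e. a compact convex set with non-empty interior that is symmetric about $\mathbf{0}$. Let $$\Lambda^*=\{\mathbf{x}\in\mathbb{R}^n:\ \mathbf{x}\cdot\mathbf{y}\in\mathbb{Z}\text{ for all }\mathbf{y}\in\Lambda\},\qquad \mathcal{C}^*=\{\mathbf{x}\in\mathbb{R}^n:\ \mathbf{x}\cdot\mathbf{y}\le 1\text{ for all }\mathbf{y}\in\mathcal{C}\}$$ be their reciprocals, where $\mathbf{x}\cdot\mathbf{y}$ is the standard inner product. For a symmetric convex body $\mathcal{K}$, a lattice $M$ in $\mathbb{R}^n$ and $1\le i\le n$, let $\lambda_i(\mathcal{K},M)$ denote the $i$-th successive minimum, i.e. the smallest real $\lambda\ge 0$ such that $\lambda\mathcal{K}\cap M$ contains $i$ linearly independent points. Then for every $i\in\{1,\dots,n\}$, $$1\le \lambda_i(\mathcal{C},\Lambda)\cdot\lambda_{n+1-i}(\mathcal{C}^*,\Lambda^*)\le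 c_3(n).$$ -/

import Mathlib

open scoped Pointwise

namespace GeomNum

/-- A symmetric convex body in `ℝⁿ`: compact, convex, symmetric about the origin, and with
non-empty interior (so that it is the unit ball of a norm on `ℝⁿ`). -/
structure IsSymmConvexBody {n : ℕ} (C : Set (EuclideanSpace ℝ (Fin n))) : Prop where
  convex : Convex ℝ C
  isCompact : IsCompact C
  symm : ∀ x ∈ C, -x ∈ C
  nonempty_interior : (interior C).Nonempty

/-- The reciprocal (polar) body `C* = {x : x ⬝ y ≤ 1 for all y ∈ C}`. -/
def reciprocalBody {n : ℕ} (C : Set (EuclideanSpace ℝ (Fin n))) :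
    Set (EuclideanSpace ℝ (Fin n)) :=
  {x | ∀ y ∈ C, inner ℝ x y ≤ 1}

/-- The reciprocal (dual) lattice `Λ* = {x : x ⬝ y ∈ ℤ for all y ∈ Λ}`. -/
def reciprocalLattice {n : ℕ} (L : Submodule ℤ (EuclideanSpace ℝ (Fin n))) :
    Submodule ℤ (EuclideanSpace ℝ (Fin n)) where
  carrier := {x | ∀ y ∈ L, ∃ m : ℤ, inner ℝ x y = (m : ℝ)}
  zero_mem' := fun y _ => ⟨0, by simp⟩
  add_mem' := by
    intro a b ha hb y hy
    obtain ⟨k, hk⟩ := ha y hy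
    obtain ⟨l, hl⟩ := hb y hy
    exact ⟨k + l, by rw [inner_add_left, hk, hl]; push_cast; rfl⟩
  smul_mem' := by
    intro c a ha y hy
    obtain ⟨k, hk⟩ := ha y hy
    refine ⟨c * k, ?_⟩
    rw [← Int.cast_smul_eq_zsmul ℝ c a, real_inner_smul_left, hk]
    push_cast
    rfl

/-- The reals `t ≥ 0` such that `t C ∩ Λ` contains `i` linearly independent points. -/
def dilationSet {n : ℕ} (C : Set (EuclideanSpace ℝ (Fin n)))
    (L : Submodule ℤ (EuclideanSpace ℝ (Fin n))) (i : ℕ) : Set ℝ :=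
  {t | 0 ≤ t ∧ ∃ v : Fin i → EuclideanSpace ℝ (Fin n),
    LinearIndependent ℝ v ∧ ∀ j, v j ∈ t • C ∧ v j ∈ L}

/-- The `i`-th successive minimum of `C` with respect to `Λ`: the smallest `t` such that
`t C ∩ Λ` contains `i` linearly independent points. For a symmetric convex body, a lattice and
`i ≤ n` the infimum is attained, see `isLeast_successiveMinimum`. -/
noncomputable def successiveMinimum {n : ℕ} (C : Set (EuclideanSpace ℝ (Fin n)))
    (L : Submodule ℤ (EuclideanSpace ℝ (Fin n))) (i : ℕ) : ℝ :=
  sInf (dilationSet C L i)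

theorem IsSymmConvexBody.mem_nhds_zero {n : ℕ} {C : Set (EuclideanSpace ℝ (Fin n))}
    (hC : IsSymmConvexBody C) : C ∈ nhds (0 : EuclideanSpace ℝ (Fin n)) := by
  obtain ⟨x, hx⟩ := hC.nonempty_interior
  have hx' : -x ∈ C := hC.symm x (interior_subset hx)
  rw [mem_interior_iff_mem_nhds.symm]
  have h := hC.convex.combo_interior_self_mem_interior hx hx'
    (show (0 : ℝ) < 1 / 2 by norm_num) (show (0 : ℝ) ≤ 1 / 2 by norm_num) (by norm_num)
  simpa using h

theorem IsSymmConvexBody.mem_smul_iff {n : ℕ} {C : Set (EuclideanSpace ℝ (Fin n))}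
    (hC : IsSymmConvexBody C) {t : ℝ} (ht : 0 ≤ t) (x : EuclideanSpace ℝ (Fin n)) :
    x ∈ t • C ↔ gauge C x ≤ t := by
  refine ⟨fun h => gauge_le_of_mem ht h, fun h => ?_⟩
  have h0 : (0 : EuclideanSpace ℝ (Fin n)) ∈ C := mem_of_mem_nhds hC.mem_nhds_zero
  have habs : Absorbent ℝ C := absorbent_nhds_zero hC.mem_nhds_zero
  rcases ht.eq_or_lt with rfl | ht'
  · have hx : gauge C x = 0 := le_antisymm h (gauge_nonneg x)
    rw [gauge_eq_zero habs ((NormedSpace.isVonNBounded_iff ℝ).2 hC.isCompact.isBounded)] at hx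
    exact ⟨0, h0, by simp [hx]⟩
  · rw [Set.mem_smul_set_iff_inv_smul_mem₀ ht'.ne']
    rw [← hC.isCompact.isClosed.closure_eq]
    apply mem_closure_of_gauge_le_one hC.convex h0 habs
    rw [gauge_smul_of_nonneg (by positivity), smul_eq_mul, inv_mul_le_one₀ ht']
    exact h

/-- The infimum in the definition of the successive minima is attained. -/
theorem isLeast_successiveMinimum {n : ℕ} {C : Set (EuclideanSpace ℝ (Fin n))}
    (hC : IsSymmConvexBody C) (L : Submodule ℤ (EuclideanSpace ℝ (Fin n)))
    [DiscreteTopology L] [IsZLattice ℝ L] {i : ℕ} (hi : i ≤ n) :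
    IsLeast (dilationSet C L i) (successiveMinimum C L i) := by
  let f : (Fin i → EuclideanSpace ℝ (Fin n)) → ℝ := fun v => ‖fun j => gauge C (v j)‖
  have hf : ∀ (t : ℝ) (v : Fin i → EuclideanSpace ℝ (Fin n)), 0 ≤ t →
      (f v ≤ t ↔ ∀ j, v j ∈ t • C) := by
    intro t v ht
    simp only [f, pi_norm_le_iff_of_nonneg ht, Real.norm_eq_abs, abs_of_nonneg (gauge_nonneg _),
      hC.mem_smul_iff ht]
  obtain ⟨w, hwi, hwL⟩ : ∃ w : Fin i → EuclideanSpace ℝ (Fin n),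
      LinearIndependent ℝ w ∧ ∀ j, w j ∈ L := by
    obtain ⟨g, hg, -, hgi⟩ := Submodule.exists_fun_fin_finrank_span_eq ℝ
      (L : Set (EuclideanSpace ℝ (Fin n)))
    have hr : i ≤ Module.finrank ℝ (Submodule.span ℝ (L : Set (EuclideanSpace ℝ (Fin n)))) := by
      rw [IsZLattice.span_top, finrank_top]
      simpa using hi
    exact ⟨fun j => g (Fin.castLE hr j), hgi.comp _ (Fin.castLE_injective hr), fun j => hg _⟩
  let S : Set (Fin i → EuclideanSpace ℝ (Fin n)) :=
    {v | LinearIndependent ℝ v ∧ (∀ j, v j ∈ L) ∧ f v ≤ f w}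
  have hSfin : S.Finite := by
    have h1 : Set.Finite ((f w • C) ∩ (L : Set (EuclideanSpace ℝ (Fin n)))) :=
      Metric.finite_isBounded_inter_isClosed DiscreteTopology.isDiscrete
        (hC.isCompact.isBounded.smul₀ (f w))
        (inferInstanceAs (IsClosed (L.toAddSubgroup : Set (EuclideanSpace ℝ (Fin n)))))
    refine (Set.Finite.pi (fun _ : Fin i => h1)).subset ?_
    rintro v ⟨-, hvL, hv⟩ j -
    exact ⟨(hf _ v (norm_nonneg _)).1 hv j, hvL j⟩
  obtain ⟨v, ⟨hvi, hvL, hvw⟩, hmin⟩ := hSfin.exists_minimalFor f S ⟨w, hwi, hwL, le_rfl⟩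
  have hleast : IsLeast (dilationSet C L i) (f v) := by
    refine ⟨⟨norm_nonneg _, v, hvi, fun j => ⟨(hf _ v (norm_nonneg _)).1 le_rfl j, hvL j⟩⟩, ?_⟩
    rintro t ⟨ht, u, hui, hu⟩
    have hut : f u ≤ t := (hf t u ht).2 fun j => (hu j).1
    by_contra! hlt
    have : f v ≤ f u := hmin ⟨hui, fun j => (hu j).2, (hut.trans hlt.le).trans hvw⟩
      (hut.trans hlt.le)
    linarith
  rw [successiveMinimum, hleast.csInf_eq]
  exact hleast

end GeomNum

open scoped Pointwise

namespace GeomNum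

/-! ### Bases adapted to a norm and a flag -/

variable {n : ℕ} {C : Set (EuclideanSpace ℝ (Fin n))}

/-! Lower bound: `i` independent vectors of the lattice and `n + 1 - i` of its reciprocal cannot be
pairwise orthogonal, and a nonzero inner product between them is an integer, so at least 1 in
absolute value; polarity bounds it by the product of the dilation factors.

Upper bound: let `v` attain all successive minima and let `B` be a lattice basis. By Cramer's rule,
replacing the `i`-th entry of `v` by `x` in `B.det` gives a functional that is integral on the
lattice, hence a vector `w i` of the reciprocal lattice. On `C` it is at most a constant times `(∏
λ_j) / (λ_i * |e.det B|)`, where `e` is a basis in `C` with coordinates bounded on `C`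
(`exists_adapted_basis`). The weak second theorem of Minkowski (`prod_successiveMinimum_le`), proved
by Blichfeldt's argument on a box along `e`, reduces this to a constant over `λ_i`. -/

theorem IsSymmConvexBody.zero_mem (hC : IsSymmConvexBody C) : 0 ∈ C :=
  mem_of_mem_nhds hC.mem_nhds_zero

theorem IsSymmConvexBody.absorbent (hC : IsSymmConvexBody C) : Absorbent ℝ C :=
  absorbent_nhds_zero hC.mem_nhds_zero

/-- The norm with unit ball `C`, as a seminorm. -/
noncomputable def IsSymmConvexBody.seminorm (hC : IsSymmConvexBody C) :
    Seminorm ℝ (EuclideanSpace ℝ (Fin n)) :=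
  gaugeSeminorm ((balanced_iff_neg_mem hC.convex).2 fun x hx => hC.symm x hx) hC.convex hC.absorbent

theorem IsSymmConvexBody.mem_smul_iff_seminorm (hC : IsSymmConvexBody C) {t : ℝ} (ht : 0 ≤ t)
    (x : EuclideanSpace ℝ (Fin n)) : x ∈ t • C ↔ hC.seminorm x ≤ t :=
  hC.mem_smul_iff ht x

theorem IsSymmConvexBody.mem_iff_seminorm (hC : IsSymmConvexBody C)
    (x : EuclideanSpace ℝ (Fin n)) : x ∈ C ↔ hC.seminorm x ≤ 1 := by
  simpa using hC.mem_smul_iff_seminorm zero_le_one x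

theorem IsSymmConvexBody.exists_eq_seminorm_smul (hC : IsSymmConvexBody C)
    (x : EuclideanSpace ℝ (Fin n)) : ∃ c ∈ C, x = hC.seminorm x • c := by
  obtain ⟨c, hc, h⟩ := (hC.mem_smul_iff_seminorm (apply_nonneg _ x) x).2 le_rfl
  exact ⟨c, hc, h.symm⟩

/-- A vector of `C` in the `k`-th step of the flag of `v` whose last coordinate is maximal. -/
theorem IsSymmConvexBody.exists_max_coord (hC : IsSymmConvexBody C)
    (v : Module.Basis (Fin n) ℝ (EuclideanSpace ℝ (Fin n))) (k : Fin n) :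
    ∃ e ∈ C, (∀ j, k < j → v.repr e j = 0) ∧ 0 < v.repr e k ∧
      ∀ x, (∀ j, k < j → v.repr x j = 0) → |v.repr x k| ≤ hC.seminorm x * v.repr e k := by
  have hcont : ∀ j, Continuous fun x => v.repr x j := fun j =>
    (v.coord j).continuous_of_finiteDimensional
  have hK : IsCompact (C ∩ {x | ∀ j, k < j → v.repr x j = 0}) := by
    refine hC.isCompact.inter_right ?_
    have : {x | ∀ j, k < j → v.repr x j = 0} = ⋂ j, ⋂ _ : k < j, {x | v.repr x j = 0} := by
      ext; simp
    rw [this]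
    exact isClosed_iInter fun j => isClosed_iInter fun _ =>
      isClosed_eq (hcont j) continuous_const
  obtain ⟨e, ⟨heC, he⟩, hmax⟩ := hK.exists_isMaxOn ⟨0, hC.zero_mem, by simp⟩ (hcont k).continuousOn
  have key : ∀ x, (∀ j, k < j → v.repr x j = 0) → v.repr x k ≤ hC.seminorm x * v.repr e k := by
    intro x hx
    obtain ⟨c, hc, hxc⟩ := hC.exists_eq_seminorm_smul x
    rcases eq_or_ne (hC.seminorm x) 0 with h0 | h0
    · rw [h0, zero_smul] at hxc
      simp [hxc]
    · have hcV : ∀ j, k < j → v.repr c j = 0 := by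
        intro j hj
        have := hx j hj
        rw [hxc] at this
        simpa [h0] using this
      have hle : v.repr c k ≤ v.repr e k := hmax ⟨hc, hcV⟩
      calc v.repr x k = hC.seminorm x * v.repr c k := by
            conv_lhs => rw [hxc]
            simp
        _ ≤ _ := mul_le_mul_of_nonneg_left hle (apply_nonneg _ _)
  refine ⟨e, heC, he, ?_, ?_⟩
  -- The maximum is positive because `v k` itself has `k`-th coordinate 1.
  · have := key (v k) (fun j hj => by simp [hj.ne])
    simp only [Module.Basis.repr_self, Finsupp.single_eq_same] at this
    exact pos_of_mul_pos_right (by linarith) (apply_nonneg _ (v k))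
  · intro x hx
    refine abs_le.2 ⟨?_, key x hx⟩
    have := key (-x) (by simpa using hx)
    rw [map_neg_eq_map hC.seminorm] at this
    simp only [map_neg, Finsupp.coe_neg, Pi.neg_apply] at this
    linarith

/-- A basis of vectors of `C` adapted to the flag of `v`, whose coordinate functionals are bounded
on `C` by `2 ^ n`. -/
theorem IsSymmConvexBody.exists_adapted_basis (hC : IsSymmConvexBody C)
    (v : Module.Basis (Fin n) ℝ (EuclideanSpace ℝ (Fin n))) :
    ∃ e : Module.Basis (Fin n) ℝ (EuclideanSpace ℝ (Fin n)), (∀ j, e j ∈ C) ∧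
      (∀ x j, |e.repr x j| ≤ 2 ^ n * hC.seminorm x) ∧
      ∀ (m : ℕ) x, (∀ j : Fin n, m ≤ j → v.repr x j = 0) →
        ∀ j : Fin n, m ≤ j → e.repr x j = 0 := by
  choose e heC heV hpos hle using hC.exists_max_coord v
  have key : ∀ m : ℕ, ∀ x, (∀ j : Fin n, m ≤ j → v.repr x j = 0) →
      ∃ a : Fin n → ℝ, x = ∑ j, a j • e j ∧ (∀ j : Fin n, m ≤ j → a j = 0) ∧
        ∀ j, |a j| ≤ 2 ^ m * hC.seminorm x := by
    intro m
    induction m with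
    | zero =>
      intro x hx
      have : x = 0 := by
        apply v.repr.injective
        ext j
        simpa using hx j (Nat.zero_le _)
      exact ⟨0, by simp [this], by simp, by simp [this]⟩
    | succ m ih =>
      intro x hx
      have hx0 := apply_nonneg hC.seminorm x
      have hpow : (1 : ℝ) ≤ 2 ^ (m + 1) := one_le_pow₀ (by norm_num)
      by_cases hm : m < n
      · set k : Fin n := ⟨m, hm⟩
        have hk := hle k x fun j hj => hx j hj
        -- Subtracting `c • e k` drops `x` one step in the flag. Maximality of `e k` gives `|c| ≤
        -- ‖x‖`, so the norm at most doubles: hence the powers of 2.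
        set c := v.repr x k / v.repr (e k) k with hc
        have hcle : |c| ≤ hC.seminorm x := by
          rw [hc, abs_div, abs_of_pos (hpos k), div_le_iff₀ (hpos k)]
          exact hk
        have hy : hC.seminorm (x - c • e k) ≤ 2 * hC.seminorm x := by
          calc _ ≤ hC.seminorm x + hC.seminorm (c • e k) := map_sub_le_add _ _ _
            _ = hC.seminorm x + |c| * hC.seminorm (e k) := by
              rw [map_smul_eq_mul, Real.norm_eq_abs]
            _ ≤ hC.seminorm x + hC.seminorm x * 1 := by
              gcongr
              exact (hC.mem_iff_seminorm _).1 (heC k)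
            _ = _ := by ring
        obtain ⟨a, hxa, ha0, ha⟩ := ih (x - c • e k) (by
          intro j hj
          rcases hj.eq_or_lt with h | h
          · have : j = k := Fin.ext h.symm
            subst this
            simp [hc, div_mul_cancel₀ _ (hpos _).ne']
          · simp [hx j h, heV k j h])
        refine ⟨a + Pi.single k c, ?_, ?_, ?_⟩
        · simp only [Pi.add_apply, add_smul, Finset.sum_add_distrib, ← hxa]
          simp [Pi.single_apply, ite_smul]
        · intro j hj
          have : j ≠ k := fun h => by simp [h, k] at hj
          simp [ha0 j (by omega), this]
        · intro j
          by_cases hj : j = k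
          · subst hj
            simp only [Pi.add_apply, Pi.single_eq_same, ha0 k le_rfl, zero_add]
            nlinarith
          · simp only [Pi.add_apply, Pi.single_eq_of_ne hj, add_zero]
            calc |a j| ≤ 2 ^ m * hC.seminorm (x - c • e k) := ha j
              _ ≤ 2 ^ m * (2 * hC.seminorm x) := by gcongr
              _ = _ := by ring
      · obtain ⟨a, hxa, -, ha⟩ := ih x fun j hj => by omega
        refine ⟨a, hxa, fun j hj => by omega, fun j => (ha j).trans ?_⟩
        gcongr
        · norm_num
        · omega
  have hspan : ⊤ ≤ Submodule.span ℝ (Set.range e) := by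
    intro x _
    obtain ⟨a, hxa, -⟩ := key n x fun j hj => by omega
    rw [hxa]
    exact Submodule.sum_mem _ fun j _ =>
      Submodule.smul_mem _ _ (Submodule.subset_span ⟨j, rfl⟩)
  let b := basisOfTopLeSpanOfCardEqFinrank e hspan (by simp)
  have hb : ∀ j, b j = e j := fun j => by simp [b]
  have hrepr : ∀ (a : Fin n → ℝ) j, b.repr (∑ i, a i • e i) j = a j := by
    intro a j
    simp only [← hb]
    exact congrFun (b.repr_sum_self a) j
  refine ⟨b, fun j => by rw [hb]; exact heC j, ?_, ?_⟩
  · intro x j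
    obtain ⟨a, hxa, -, ha⟩ := key n x fun j hj => by omega
    have := ha j
    rwa [← hrepr a j, ← hxa] at this
  · intro m x hx j hj
    obtain ⟨a, hxa, ha, -⟩ := key m x hx
    rw [hxa, hrepr, ha j hj]

/-! ### Successive minima and a weak second theorem of Minkowski -/

variable (L : Submodule ℤ (EuclideanSpace ℝ (Fin n))) [DiscreteTopology L] [IsZLattice ℝ L]

theorem successiveMinimum_mono (hC : IsSymmConvexBody C) {i j : ℕ} (hij : i ≤ j) (hj : j ≤ n) :
    successiveMinimum C L i ≤ successiveMinimum C L j := by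
  obtain ⟨h0, v, hv, hvL⟩ := (isLeast_successiveMinimum hC L hj).1
  exact (isLeast_successiveMinimum hC L (hij.trans hj)).2
    ⟨h0, fun k => v (Fin.castLE hij k), hv.comp _ (Fin.castLE_injective hij), fun k => hvL _⟩

theorem successiveMinimum_pos (hC : IsSymmConvexBody C) {i : ℕ} (hi : 1 ≤ i) (hin : i ≤ n) :
    0 < successiveMinimum C L i := by
  obtain ⟨h0, v, hv, hvL⟩ := (isLeast_successiveMinimum hC L hin).1
  refine h0.lt_of_ne fun h => hv.ne_zero ⟨0, hi⟩ ?_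
  obtain ⟨c, -, hc⟩ := (hvL ⟨0, hi⟩).1
  rw [← hc, ← h]
  exact zero_smul _ _

/-- Linearly independent lattice points attaining all successive minima simultaneously. -/
theorem exists_basis_mem_successiveMinimum_smul (hC : IsSymmConvexBody C) :
    ∃ v : Module.Basis (Fin n) ℝ (EuclideanSpace ℝ (Fin n)),
      ∀ j : Fin n, v j ∈ L ∧ v j ∈ successiveMinimum C L (j + 1) • C := by
  have key : ∀ m ≤ n, ∃ v : Fin m → EuclideanSpace ℝ (Fin n), LinearIndependent ℝ v ∧
      ∀ j, v j ∈ L ∧ v j ∈ successiveMinimum C L (j + 1) • C := by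
    intro m
    induction m with
    | zero => exact fun _ => ⟨fun j => j.elim0, linearIndependent_empty_type, fun j => j.elim0⟩
    | succ m ih =>
      intro hm
      obtain ⟨v, hv, hvL⟩ := ih (by omega)
      obtain ⟨-, u, hu, huL⟩ := (isLeast_successiveMinimum hC L hm).1
      obtain ⟨j, hj⟩ : ∃ j, u j ∉ Submodule.span ℝ (Set.range v) := by
        by_contra! h
        have hle : Submodule.span ℝ (Set.range u) ≤ Submodule.span ℝ (Set.range v) :=
          Submodule.span_le.2 (by rintro _ ⟨j, rfl⟩; exact h j)
        have := Submodule.finrank_mono hle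
        rw [finrank_span_eq_card hu, finrank_span_eq_card hv] at this
        simp at this
      refine ⟨Fin.snoc v (u j), linearIndependent_finSnoc.2 ⟨hv, hj⟩, fun i => ?_⟩
      induction i using Fin.lastCases with
      | last => simpa using ⟨(huL j).2, (huL j).1⟩
      | cast i => simpa using hvL i
  obtain ⟨v, hv, hvL⟩ := key n le_rfl
  have hspan := (hv.span_eq_top_of_card_eq_finrank' (by simp)).ge
  exact ⟨basisOfTopLeSpanOfCardEqFinrank v hspan (by simp), by simpa using hvL⟩

/-- A lattice point outside the span of the first `k` vectors of a basis attaining the successive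
minima has norm at least the next successive minimum. -/
theorem successiveMinimum_le_of_repr_ne_zero (hC : IsSymmConvexBody C)
    (v : Module.Basis (Fin n) ℝ (EuclideanSpace ℝ (Fin n)))
    (hv : ∀ j : Fin n, v j ∈ L ∧ v j ∈ successiveMinimum C L (j + 1) • C)
    {x : EuclideanSpace ℝ (Fin n)} (hx : x ∈ L) {k : Fin n} (hk : v.repr x k ≠ 0) :
    successiveMinimum C L (k + 1) ≤ hC.seminorm x := by
  by_contra! hlt
  have hex : ∃ j : ℕ, hC.seminorm x < successiveMinimum C L (j + 1) := ⟨k, hlt⟩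
  classical
  -- For the least such `j`, the first `j` basis vectors have norm at most that of `x`; adding `x`
  -- gives `j + 1` independent points that are too short.
  obtain ⟨j, hj, hmin⟩ : ∃ j : ℕ, hC.seminorm x < successiveMinimum C L (j + 1) ∧
      ∀ i < j, successiveMinimum C L (i + 1) ≤ hC.seminorm x :=
    ⟨Nat.find hex, Nat.find_spec hex, fun i hi => not_lt.1 (Nat.find_min hex hi)⟩
  have hjk : j ≤ k := by
    by_contra! h
    exact absurd (hmin k h) hlt.not_ge
  have hjn : j ≤ n := hjk.trans k.2.le
  refine hj.not_ge ((isLeast_successiveMinimum hC L (by omega)).2 ⟨apply_nonneg hC.seminorm x,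
    Fin.snoc (fun i : Fin j => v (Fin.castLE hjn i)) x, linearIndependent_finSnoc.2
      ⟨v.linearIndependent.comp _ (Fin.castLE_injective hjn), fun hmem => hk ?_⟩, fun i => ?_⟩)
  · have hle : Submodule.span ℝ (Set.range fun i : Fin j => v (Fin.castLE hjn i)) ≤
        LinearMap.ker (v.coord k) := by
      refine Submodule.span_le.2 ?_
      rintro _ ⟨i, rfl⟩
      have : Fin.castLE hjn i ≠ k := by
        intro h
        have := congrArg Fin.val h
        simp at this
        omega
      simp [this]
    simpa using hle hmem
  · induction i using Fin.lastCases with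
    | last =>
      rw [Fin.snoc_last]
      exact ⟨(hC.mem_smul_iff_seminorm (apply_nonneg hC.seminorm x) x).2 le_rfl, hx⟩
    | cast i =>
      simp only [Fin.snoc_castSucc]
      have hi : i.val + 1 ≤ n := by omega
      have hpos := successiveMinimum_pos L hC (Nat.le_add_left 1 i.val) hi
      refine ⟨(hC.mem_smul_iff_seminorm (apply_nonneg hC.seminorm x) _).2 ?_, (hv _).1⟩
      refine le_trans ?_ (hmin i i.2)
      exact (hC.mem_smul_iff_seminorm hpos.le _).1 (hv (Fin.castLE hjn i)).2

/-- A weak form of Minkowski's second theorem: the product of the successive minima is bounded by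
the covolume, measured in a basis of vectors of `C` adapted to the successive minima. -/
theorem prod_successiveMinimum_le (hC : IsSymmConvexBody C)
    (v e : Module.Basis (Fin n) ℝ (EuclideanSpace ℝ (Fin n)))
    (hv : ∀ j : Fin n, v j ∈ L ∧ v j ∈ successiveMinimum C L (j + 1) • C)
    (heC : ∀ j : Fin n, e j ∈ C)
    (he : ∀ (m : ℕ) x, (∀ j : Fin n, m ≤ j → v.repr x j = 0) →
        ∀ j : Fin n, m ≤ j → e.repr x j = 0)
    (b : Module.Basis (Fin n) ℤ L) :
    ∏ j : Fin n, successiveMinimum C L (j + 1) ≤ (n : ℝ) ^ n * |e.det (b.ofZLatticeBasis ℝ L)| := by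
  by_contra! hlt
  have hn : ∀ _ : Fin n, (0 : ℝ) < n := fun k => by exact_mod_cast k.pos
  have hpos : ∀ j : Fin n, 0 < successiveMinimum C L (j + 1) / n := fun j =>
    div_pos (successiveMinimum_pos L hC (by omega) (by omega)) (hn j)
  -- The sides are divided by `n` so that a sum of `n` coordinates stays below a single minimum.
  let f := e.isUnitSMul (w := fun j : Fin n => successiveMinimum C L (j + 1) / n)
    fun j => (hpos j).ne'.isUnit
  have hf : ∀ j : Fin n, f j = (successiveMinimum C L (j + 1) / n) • e j := fun j => by
    simp [f, Module.Basis.isUnitSMul_apply]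
  have hrepr : ∀ x j, e.repr x j = f.repr x j * (successiveMinimum C L (j + 1) / n) := by
    intro x j
    conv_lhs => rw [← f.sum_repr x]
    simp only [hf, smul_smul]
    exact congrFun (e.repr_sum_self
      fun j : Fin n => f.repr x j * (successiveMinimum C L (j + 1) / n)) j
  have hdet : e.det f = ∏ j : Fin n, successiveMinimum C L (j + 1) / n := by
    have : (f : Fin n → _) = fun j : Fin n => (successiveMinimum C L (j + 1) / n) • e j := funext hf
    rw [this, AlternatingMap.map_smul_univ, e.det_self, smul_eq_mul, mul_one]
  have hvol : MeasureTheory.volume (ZSpan.fundamentalDomain (b.ofZLatticeBasis ℝ L)) <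
      MeasureTheory.volume (ZSpan.fundamentalDomain f) := by
    rw [ZSpan.measure_fundamentalDomain _ _ e, ZSpan.measure_fundamentalDomain f _ e]
    refine ENNReal.mul_lt_mul_left (ZSpan.measure_fundamentalDomain_ne_zero e)
      (ZSpan.fundamentalDomain_isBounded e).measure_lt_top.ne ?_
    rw [hdet, abs_of_pos (Finset.prod_pos fun j _ => hpos j), Finset.prod_div_distrib]
    have hnn : (0 : ℝ) < (n : ℝ) ^ n := by
      rcases Nat.eq_zero_or_pos n with rfl | h
      · simp
      · positivity
    have hlt' : |e.det (b.ofZLatticeBasis ℝ L)| <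
        (∏ j : Fin n, successiveMinimum C L (j + 1)) / ∏ _j : Fin n, (n : ℝ) := by
      rw [Finset.prod_const, Finset.card_univ, Fintype.card_fin, lt_div_iff₀ hnn, mul_comm]
      exact hlt
    exact (ENNReal.ofReal_lt_ofReal_iff ((abs_nonneg _).trans_lt hlt')).2 hlt'
  have : Countable L.toAddSubgroup := inferInstanceAs (Countable L)
  -- Blichfeldt: the box exceeds the covolume, so two distinct lattice translates of it meet.
  obtain ⟨x, y, hxy, hdis⟩ := MeasureTheory.exists_pair_mem_lattice_not_disjoint_vadd
    (L := L.toAddSubgroup)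
    (ZLattice.isAddFundamentalDomain b MeasureTheory.volume)
    (ZSpan.fundamentalDomain_measurableSet f).nullMeasurableSet hvol
  obtain ⟨_, ⟨p, hp, rfl⟩, ⟨q, hq, hpq⟩⟩ := Set.not_disjoint_iff.1 hdis
  replace hpq : (y : EuclideanSpace ℝ (Fin n)) + q = x + p := hpq
  set z : EuclideanSpace ℝ (Fin n) := x - y with hz
  have hzL : z ∈ L := L.sub_mem x.2 y.2
  have hz0 : z ≠ 0 := fun h => hxy (Subtype.ext (sub_eq_zero.1 h))
  have hzq : z = q - p := by
    rw [hz, sub_eq_sub_iff_add_eq_add, add_comm q, hpq]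
  have hzcoord : ∀ j : Fin n, |e.repr z j| < successiveMinimum C L (j + 1) / n := by
    intro j
    have h1 : |f.repr z j| < 1 := by
      have hp' := hp j
      have hq' := hq j
      rw [hzq, map_sub, Finsupp.sub_apply, abs_lt]
      exact ⟨by linarith [hp'.2, hq'.1], by linarith [hp'.1, hq'.2]⟩
    rw [hrepr, abs_mul, abs_of_pos (hpos j)]
    exact mul_lt_of_lt_one_left (hpos j) h1
  -- With `k` the last nonzero `v`-coordinate, the flag condition kills the `e`-coordinates beyond
  -- `k`, and monotonicity bounds the others by `λ_{k+1} / n`.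
  obtain ⟨k, hk, hkmax⟩ : ∃ k, v.repr z k ≠ 0 ∧ ∀ j, k < j → v.repr z j = 0 := by
    have hne : (v.repr z).support.Nonempty := by
      rw [Finsupp.support_nonempty_iff]
      simpa using hz0
    refine ⟨(v.repr z).support.max' hne, Finsupp.mem_support_iff.1 (Finset.max'_mem _ _),
      fun j hj => ?_⟩
    by_contra h
    exact hj.not_ge (Finset.le_max' _ _ (Finsupp.mem_support_iff.2 h))
  have hlam := successiveMinimum_le_of_repr_ne_zero L hC v hv hzL hk
  refine hlam.not_gt ?_
  have hterm : ∀ j : Fin n, |e.repr z j| < successiveMinimum C L (k + 1) / n := by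
    intro j
    rcases le_or_gt j k with h | h
    · refine (hzcoord j).trans_le ?_
      gcongr
      exact successiveMinimum_mono L hC (by simpa using h) (by omega)
    · rw [he (k + 1) z (fun j hj => hkmax j hj) j h, abs_zero]
      exact hpos k
  calc hC.seminorm z = hC.seminorm (∑ j, e.repr z j • e j) := by rw [e.sum_repr]
    _ ≤ ∑ j, hC.seminorm (e.repr z j • e j) :=
      Finset.le_sum_of_subadditive hC.seminorm (map_zero _).le (map_add_le_add _) _ _
    _ ≤ ∑ j, |e.repr z j| := by
      refine Finset.sum_le_sum fun j _ => ?_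
      rw [map_smul_eq_mul, Real.norm_eq_abs]
      exact mul_le_of_le_one_right (abs_nonneg _) ((hC.mem_iff_seminorm _).1 (heC j))
    _ < ∑ _j : Fin n, successiveMinimum C L (k + 1) / n :=
      Finset.sum_lt_sum_of_nonempty ⟨k, Finset.mem_univ k⟩ fun j _ => hterm j
    _ = successiveMinimum C L (k + 1) := by
      rw [Finset.sum_const, Finset.card_univ, Fintype.card_fin, nsmul_eq_mul,
        mul_div_cancel₀ _ (hn k).ne']

/-! ### Reciprocal lattice vectors from determinants -/

theorem exists_int_eq_det {ι : Type*} [Fintype ι] [DecidableEq ι] (b : Module.Basis ι ℤ L)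
    {u : ι → EuclideanSpace ℝ (Fin n)} (hu : ∀ j, u j ∈ L) :
    ∃ m : ℤ, (b.ofZLatticeBasis ℝ L).det u = m := by
  refine ⟨(b.toMatrix fun j => ⟨u j, hu j⟩).det, ?_⟩
  rw [Module.Basis.det_apply, ← eq_intCast (Int.castRingHom ℝ), RingHom.map_det]
  congr 1
  ext i j
  simpa [Module.Basis.toMatrix_apply] using b.ofZLatticeBasis_repr_apply ℝ L ⟨u j, hu j⟩ i

/-- Leibniz expansion: `n!` products of `n` coordinates, each at most `2 ^ n`. -/
theorem IsSymmConvexBody.abs_det_le (hC : IsSymmConvexBody C)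
    (e : Module.Basis (Fin n) ℝ (EuclideanSpace ℝ (Fin n)))
    (he : ∀ x j, |e.repr x j| ≤ 2 ^ n * hC.seminorm x)
    {u : Fin n → EuclideanSpace ℝ (Fin n)} (hu : ∀ j, u j ∈ C) :
    |e.det u| ≤ n.factorial * (2 ^ n) ^ n := by
  rw [Module.Basis.det_apply]
  have := Matrix.det_le (A := e.toMatrix u) (abv := AbsoluteValue.abs) (x := (2 : ℝ) ^ n) ?_
  · simpa using this
  · intro i j
    rw [AbsoluteValue.abs_apply, Module.Basis.toMatrix_apply]
    refine (he (u j) i).trans (mul_le_of_le_one_right (by positivity) ?_)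
    exact (hC.mem_iff_seminorm _).1 (hu j)

/-- Linearly independent vectors of the reciprocal lattice bounded in terms of the successive
minima. -/
theorem exists_linearIndependent_reciprocalLattice (hC : IsSymmConvexBody C) :
    ∃ w : Fin n → EuclideanSpace ℝ (Fin n), LinearIndependent ℝ w ∧
      ∀ j : Fin n, w j ∈ reciprocalLattice L ∧ ∀ x ∈ C,
        inner ℝ (w j) x * successiveMinimum C L (j + 1) ≤
          n.factorial * (2 ^ n) ^ n * (n : ℝ) ^ n := by
  obtain ⟨v, hv⟩ := exists_basis_mem_successiveMinimum_smul L hC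
  obtain ⟨e, heC, hebound, heflag⟩ := hC.exists_adapted_basis v
  have := ZLattice.module_finite ℝ L
  have := ZLattice.module_free ℝ L
  let b : Module.Basis (Fin n) ℤ L :=
    Module.finBasisOfFinrankEq ℤ L (by rw [ZLattice.rank ℝ L]; simp)
  set B := b.ofZLatticeBasis ℝ L
  have hprod := prod_successiveMinimum_le L hC v e hv heC heflag b
  let φ : Fin n → EuclideanSpace ℝ (Fin n) →L[ℝ] ℝ := fun i =>
    (B.det.toMultilinearMap.toLinearMap v i).toContinuousLinearMap
  let w : Fin n → EuclideanSpace ℝ (Fin n) := fun i =>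
    (InnerProductSpace.toDual ℝ (EuclideanSpace ℝ (Fin n))).symm (φ i)
  have hw : ∀ i x, inner ℝ (w i) x = B.det (Function.update v i x) := fun i x => by
    simp only [w, InnerProductSpace.toDual_symm_apply]
    rfl
  have hpos : ∀ j : Fin n, 0 < successiveMinimum C L (j + 1) := fun j =>
    successiveMinimum_pos L hC (by omega) (by omega)
  refine ⟨w, ?_, fun i => ⟨fun y hy => ?_, fun x hx => ?_⟩⟩
  -- The pairing of `w` with `v` is diagonal, since off the diagonal the determinant has a repeated
  -- entry.
  · rw [Fintype.linearIndependent_iff]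
    intro c hc j
    have h0 : inner ℝ (∑ i, c i • w i) (v j) = 0 := by rw [hc, inner_zero_left]
    simp only [sum_inner, real_inner_smul_left, hw] at h0
    rw [Finset.sum_eq_single j] at h0
    · rw [Function.update_eq_self] at h0
      exact (mul_eq_zero.1 h0).resolve_right (B.isUnit_det v).ne_zero
    · intro i _ hij
      rw [AlternatingMap.map_update_self _ _ hij, mul_zero]
    · simp
  · rw [hw]
    refine exists_int_eq_det L b fun j => ?_
    rcases eq_or_ne j i with rfl | h
    · simpa using hy
    · simpa [h] using (hv j).1
  · rw [hw]
    choose u huC hu using fun j => (hv j).2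
    let lam : Fin n → ℝ := fun j => successiveMinimum C L (j + 1)
    -- Slot `i` carries the factor 1; the extra `λ_i` in the claim completes the product of all
    -- minima.
    have hupd : Function.update (v : Fin n → _) i x =
        fun j => Function.update lam i 1 j • Function.update u i x j := by
      ext1 j
      rcases eq_or_ne j i with rfl | h
      · simp
      · simp [h, lam, ← hu j]
    have hdetB : e.det B ≠ 0 := (e.isUnit_det B).ne_zero
    have hBe : ∀ y : Fin n → EuclideanSpace ℝ (Fin n), e.det B * B.det y = e.det y := by
      intro y
      have h := congrArg (fun g => g y) (e.det.eq_smul_basis_det B)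
      simpa using h.symm
    have hlam : (∏ j, Function.update lam i 1 j) * lam i = ∏ j, lam j := by
      rw [Finset.prod_update_of_mem (Finset.mem_univ i), one_mul, mul_comm,
        ← Finset.mul_prod_erase _ _ (Finset.mem_univ i), Finset.sdiff_singleton_eq_erase]
    have hmem : ∀ j, Function.update u i x j ∈ C := by
      intro j
      rcases eq_or_ne j i with rfl | h
      · simpa using hx
      · simpa [h] using huC j
    have hdu := hC.abs_det_le e hebound hmem
    have hpp : 0 < ∏ j, lam j := Finset.prod_pos fun j _ => hpos j
    have heq : e.det B * (B.det (Function.update v i x) * lam i) =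
        (∏ j, lam j) * e.det (Function.update u i x) := by
      rw [← mul_assoc, hBe, hupd, AlternatingMap.map_smul_univ, smul_eq_mul, ← hlam]
      ring
    have habs : |e.det B| * |B.det (Function.update v i x) * lam i| ≤
        |e.det B| * (n.factorial * (2 ^ n) ^ n * (n : ℝ) ^ n) := by
      rw [← abs_mul, heq, abs_mul, abs_of_pos hpp]
      calc _ ≤ ((n : ℝ) ^ n * |e.det B|) * (n.factorial * (2 ^ n) ^ n) := by
            gcongr
        _ = _ := by ring
    exact (le_abs_self _).trans (le_of_mul_le_mul_left habs (abs_pos.2 hdetB))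

/-! ### The two transference inequalities -/

/-- Otherwise one span lies in the orthogonal complement of the other, forcing `i + k ≤ n`. -/
theorem exists_inner_ne_zero {i k : ℕ} (h : n < i + k)
    {v : Fin i → EuclideanSpace ℝ (Fin n)} {w : Fin k → EuclideanSpace ℝ (Fin n)}
    (hv : LinearIndependent ℝ v) (hw : LinearIndependent ℝ w) :
    ∃ a b, inner ℝ (w b) (v a) ≠ 0 := by
  by_contra! h0
  have hle : Submodule.span ℝ (Set.range v) ≤ (Submodule.span ℝ (Set.range w))ᗮ := by
    rw [Submodule.le_orthogonal_iff_le_orthogonal, Submodule.span_le]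
    rintro _ ⟨b, rfl⟩
    rw [SetLike.mem_coe, Submodule.mem_orthogonal]
    intro u hu
    induction hu using Submodule.span_induction with
    | mem x hx => obtain ⟨a, rfl⟩ := hx; rw [real_inner_comm]; exact h0 a b
    | zero => simp
    | add x y _ _ hx hy => rw [inner_add_left, hx, hy, add_zero]
    | smul c x _ hx => rw [real_inner_smul_left, hx, mul_zero]
  have h1 := Submodule.finrank_mono hle
  have h2 := (Submodule.span ℝ (Set.range w)).finrank_add_finrank_orthogonal
  rw [finrank_span_eq_card hv] at h1
  rw [finrank_span_eq_card hw] at h2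
  simp at h1 h2
  omega

theorem one_le_successiveMinimum_mul (hC : IsSymmConvexBody C) {i k : ℕ} (hi : i ≤ n)
    (h : n < i + k) {t : ℝ}
    (ht : t ∈ dilationSet (reciprocalBody C) (reciprocalLattice L) k) :
    1 ≤ successiveMinimum C L i * t := by
  obtain ⟨hlam, v, hv, hvL⟩ := (isLeast_successiveMinimum hC L hi).1
  obtain ⟨ht0, w, hw, hwL⟩ := ht
  obtain ⟨a, b, hab⟩ := exists_inner_ne_zero h hv hw
  obtain ⟨m, hm⟩ := (hwL b).2 (v a) (hvL a).2
  have hm0 : m ≠ 0 := by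
    rintro rfl
    exact hab (by simpa using hm)
  have hm1 : (1 : ℝ) ≤ |inner ℝ (w b) (v a)| := by
    rw [hm]
    exact_mod_cast Int.one_le_abs hm0
  obtain ⟨x, hx, hxv⟩ := (hvL a).1
  obtain ⟨y, hy, hyw⟩ := (hwL b).1
  have hyx : |inner ℝ y x| ≤ 1 := by
    refine abs_le.2 ⟨?_, hy x hx⟩
    have := hy (-x) (hC.symm x hx)
    rw [inner_neg_right] at this
    linarith
  calc (1 : ℝ) ≤ |inner ℝ (w b) (v a)| := hm1
    _ = successiveMinimum C L i * t * |inner ℝ y x| := by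
      rw [← hxv, ← hyw]
      simp only [real_inner_smul_left, real_inner_smul_right, abs_mul, abs_of_nonneg hlam,
        abs_of_nonneg ht0]
      ring
    _ ≤ _ := mul_le_of_le_one_right (mul_nonneg hlam ht0) hyx

theorem div_successiveMinimum_mem_dilationSet (hC : IsSymmConvexBody C) {i : ℕ} (hi : 1 ≤ i)
    (hin : i ≤ n) :
    (n.factorial * (2 ^ n) ^ n * (n : ℝ) ^ n) / successiveMinimum C L i ∈
      dilationSet (reciprocalBody C) (reciprocalLattice L) (n + 1 - i) := by
  obtain ⟨w, hw, hwL⟩ := exists_linearIndependent_reciprocalLattice L hC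
  have hlam := successiveMinimum_pos L hC hi hin
  have hn : (0 : ℝ) < n := by exact_mod_cast hi.trans hin
  set K : ℝ := n.factorial * (2 ^ n) ^ n * (n : ℝ) ^ n
  have hK : 0 < K := by positivity
  have hKl : 0 < K / successiveMinimum C L i := div_pos hK hlam
  -- The zero-based indices `i - 1, …, n - 1`: exactly those whose minimum is at least `λ_i`.
  let g : Fin (n + 1 - i) → Fin n := fun j => ⟨i - 1 + j, by omega⟩
  have hg : Function.Injective g := fun j l h => by
    have := congrArg Fin.val h
    simp only [g] at this
    ext
    omega
  refine ⟨hKl.le, w ∘ g, hw.comp g hg, fun j => ⟨?_, (hwL (g j)).1⟩⟩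
  rw [Set.mem_smul_set_iff_inv_smul_mem₀ hKl.ne']
  intro x hx
  rw [real_inner_smul_left, inv_mul_le_one₀ hKl, Function.comp_apply]
  rcases le_or_gt (inner ℝ (w (g j)) x) 0 with h0 | h0
  · exact h0.trans hKl.le
  · rw [le_div_iff₀ hlam]
    refine le_trans ?_ ((hwL (g j)).2 x hx)
    gcongr
    exact successiveMinimum_mono L hC (by simp only [g]; omega) (by omega)

end GeomNum

theorem theorem2p2 (n : ℕ) (hn : 2 ≤ n) :
    ∃ c₃ : ℝ, 0 < c₃ ∧
      ∀ (L : Submodule ℤ (EuclideanSpace ℝ (Fin n))) [DiscreteTopology L] [IsZLattice ℝ L]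
        (C : Set (EuclideanSpace ℝ (Fin n))), GeomNum.IsSymmConvexBody C →
        ∀ i : ℕ, 1 ≤ i → i ≤ n →
          1 ≤ GeomNum.successiveMinimum C L i *
              GeomNum.successiveMinimum (GeomNum.reciprocalBody C)
                (GeomNum.reciprocalLattice L) (n + 1 - i) ∧
          GeomNum.successiveMinimum C L i *
              GeomNum.successiveMinimum (GeomNum.reciprocalBody C)
                (GeomNum.reciprocalLattice L) (n + 1 - i) ≤ c₃ := by
  have hn0 : (0 : ℝ) < n := by exact_mod_cast (by omega : 0 < n)
  refine ⟨n.factorial * (2 ^ n) ^ n * (n : ℝ) ^ n, by positivity, ?_⟩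
  intro L _ _ C hC i hi hin
  have hlam := GeomNum.successiveMinimum_pos L hC hi hin
  have hmem := GeomNum.div_successiveMinimum_mem_dilationSet L hC hi hin
  constructor
  · rw [mul_comm, ← div_le_iff₀ hlam]
    -- Nonemptiness comes from the upper bound's witness and excludes the default `sInf ∅ = 0`;
    -- attainment on the reciprocal side is not needed.
    refine le_csInf ⟨_, hmem⟩ fun t ht => ?_
    rw [div_le_iff₀ hlam, mul_comm]
    exact GeomNum.one_le_successiveMinimum_mul L hC hin (by omega) ht
  · rw [mul_comm, ← le_div_iff₀ hlam]
    exact csInf_le ⟨0, fun t ht => ht.1⟩ hmem
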